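/- Let $0<\theta<1$ be irrational and let $h:\mathbb{R}\to\mathbb{R}$ be even, smooth and exponentially decaying, i.e. $|h(\eta)|\le Ce^{-c|\eta|}$ for all $\eta\in\mathbb{R}$, for some constants $C$ and $c>0$. For $b\in\mathbb{R}$ let $H_r(b)$ be the bounded self-adjoint operator on $\ell^2(\mathbb{Z})$ (the reduced incommensurate coupled chain model) given by $$(H_r(b)\psi)_n=\psi_{n+1}+\psi_{n-1}+\sum_{n'\in\mathbb{Z}}h(n-(1-\theta)n'-b)\sum_{n''\in\mathbb{Z}}h(n''-(1-\theta)n'-b)\,\psi_{n''},\qquad n\in\mathbb{Z}.$$ For a positive integer $L$ let $\Lambda_L=[-L,L]\cap\mathbb{Z}$ and let $H_{r,L}(b)=1_{\Lambda_L}H_r(b)1_{\Lambda_L}$, where $1_{\Lambda_L}$ is multiplication by the characteristic function of $\Lambda_L$; let $\delta_x\in\ell^2(\mathbb{Z})$ be the vector with entry $1$ at $x$ and $0$ elsewhere. Then for every continuous function $g:\mathbb{R}\to\mathbb{C}$, the function $b'\mapsto\langle\delta_0,g(H_r(b'))\delta_0\rangle$ is integrable on $[0,1-\theta]$, and for every $b\in[0,1-\theta)$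 $$\lim_{L\to\infty}\frac{1}{|\Lambda_L|}\sum_{x\in\Lambda_L}\langle\delta_x,g(H_{r,L}(b))\delta_x\rangle=\frac{1}{1-\theta}\int_0^{1-\theta}\langle\delta_0,g(H_r(b'))\delta_0\rangle\,db'.$$ That is, the density of states is obtained by averaging the interlayer shift over the unit cell of the fictitious second layer. -/

import Mathlib

open Filter Topology MeasureTheory
open scoped ContDiff

/-- The Hilbert space `ℓ²(ℤ)` of square-summable complex sequences indexed by `ℤ`. -/
abbrev EllTwo : Type := lp (fun _ : ℤ => ℂ) 2

/-- The vector `δ_x`, whose entry at `x` is `1` and whose other entries are `0`. -/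
noncomputable def deltaVec (x : ℤ) : EllTwo := lp.single 2 x (1 : ℂ)

/-- Uniform bounds on the absolute row and column sums of an infinite real matrix. -/
def HasSchurBound (K : ℤ → ℤ → ℝ) : Prop :=
  ∃ M : ℝ, (∀ n (s : Finset ℤ), ∑ m ∈ s, |K n m| ≤ M) ∧ (∀ m (s : Finset ℤ), ∑ n ∈ s, |K n m| ≤ M)

theorem EllTwo.summable_sq (ψ : EllTwo) : Summable fun m => ‖ψ m‖ ^ 2 := by
  have h := (lp.memℓp ψ).summable (by norm_num)
  simpa using h

theorem EllTwo.norm_sq (ψ : EllTwo) : ‖ψ‖ ^ 2 = ∑' m, ‖ψ m‖ ^ 2 := by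
  have h := lp.norm_rpow_eq_tsum (p := 2) (by norm_num) ψ
  simpa using h

theorem HasSchurBound.transpose {K : ℤ → ℤ → ℝ} (hK : HasSchurBound K) :
    HasSchurBound fun n m => K m n := by
  obtain ⟨M, h1, h2⟩ := hK
  exact ⟨M, h2, h1⟩

theorem schur_summable_abs {K : ℤ → ℤ → ℝ} (hK : HasSchurBound K) (ψ : EllTwo) (n : ℤ) :
    Summable fun m => |K n m| * ‖ψ m‖ := by
  obtain ⟨M, h1, -⟩ := hK
  have hs : Summable fun m => |K n m| := summable_of_sum_le (fun _ => abs_nonneg _) (h1 n)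
  refine Summable.of_nonneg_of_le (fun m => by positivity) (fun m => ?_) (hs.mul_right ‖ψ‖)
  exact mul_le_mul_of_nonneg_left (lp.norm_apply_le_norm (by norm_num) ψ m) (abs_nonneg _)

/-- The series defining the matrix action converge absolutely. -/
theorem schur_summable {K : ℤ → ℤ → ℝ} (hK : HasSchurBound K) (ψ : EllTwo) (n : ℤ) :
    Summable fun m => (K n m : ℂ) * ψ m := by
  refine Summable.of_norm ?_
  simpa using schur_summable_abs hK ψ n

theorem schur_sum_le {K : ℤ → ℤ → ℝ} {M : ℝ}
    (h1 : ∀ n (s : Finset ℤ), ∑ m ∈ s, |K n m| ≤ M)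
    (h2 : ∀ m (s : Finset ℤ), ∑ n ∈ s, |K n m| ≤ M) (ψ : EllTwo) (s : Finset ℤ) :
    ∑ n ∈ s, ‖∑' m, (K n m : ℂ) * ψ m‖ ^ 2 ≤ M ^ 2 * ‖ψ‖ ^ 2 := by
  have hM : 0 ≤ M := by simpa using h1 0 ∅
  have hle : ∀ n m, |K n m| ≤ M := fun n m => by simpa using h1 n {m}
  have hsq : ∀ n, Summable fun m => |K n m| * ‖ψ m‖ ^ 2 := fun n =>
    Summable.of_nonneg_of_le (fun m => by positivity)
      (fun m => mul_le_mul_of_nonneg_right (hle n m) (by positivity)) (ψ.summable_sq.mul_left M)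
  have hrow : ∀ n, ‖∑' m, (K n m : ℂ) * ψ m‖ ^ 2 ≤ M * ∑' m, |K n m| * ‖ψ m‖ ^ 2 := by
    intro n
    have hfin : ∀ t : Finset ℤ, ∑ m ∈ t, |K n m| * ‖ψ m‖
        ≤ Real.sqrt (M * ∑' m, |K n m| * ‖ψ m‖ ^ 2) := by
      intro t
      refine Real.le_sqrt_of_sq_le ?_
      calc (∑ m ∈ t, |K n m| * ‖ψ m‖) ^ 2
          ≤ (∑ m ∈ t, |K n m|) * ∑ m ∈ t, |K n m| * ‖ψ m‖ ^ 2 :=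
            Finset.sum_sq_le_sum_mul_sum_of_sq_le_mul t (fun _ _ => abs_nonneg _)
              (fun _ _ => by positivity) (fun _ _ => le_of_eq (by ring))
        _ ≤ M * ∑' m, |K n m| * ‖ψ m‖ ^ 2 :=
            mul_le_mul (h1 n t) ((hsq n).sum_le_tsum t (fun _ _ => by positivity))
              (Finset.sum_nonneg fun _ _ => by positivity) hM
    have hn : ‖∑' m, (K n m : ℂ) * ψ m‖ ≤ Real.sqrt (M * ∑' m, |K n m| * ‖ψ m‖ ^ 2) := by
      refine (norm_tsum_le_tsum_norm ?_).trans ?_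
      · simpa using schur_summable_abs ⟨M, h1, h2⟩ ψ n
      · simpa using (schur_summable_abs ⟨M, h1, h2⟩ ψ n).tsum_le_of_sum_le hfin
    calc ‖∑' m, (K n m : ℂ) * ψ m‖ ^ 2
        ≤ Real.sqrt (M * ∑' m, |K n m| * ‖ψ m‖ ^ 2) ^ 2 := by gcongr
      _ = _ := Real.sq_sqrt (mul_nonneg hM (tsum_nonneg fun _ => by positivity))
  calc ∑ n ∈ s, ‖∑' m, (K n m : ℂ) * ψ m‖ ^ 2
      ≤ ∑ n ∈ s, M * ∑' m, |K n m| * ‖ψ m‖ ^ 2 := Finset.sum_le_sum fun n _ => hrow n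
    _ = M * ∑' m, ∑ n ∈ s, |K n m| * ‖ψ m‖ ^ 2 := by
        rw [← Finset.mul_sum, Summable.tsum_finsetSum fun n _ => hsq n]
    _ ≤ M * ∑' m, M * ‖ψ m‖ ^ 2 := by
        refine mul_le_mul_of_nonneg_left ?_ hM
        refine Summable.tsum_le_tsum (fun m => ?_) (summable_sum fun n _ => hsq n)
          (ψ.summable_sq.mul_left M)
        rw [← Finset.sum_mul]
        exact mul_le_mul_of_nonneg_right (h2 m s) (by positivity)
    _ = M ^ 2 * ‖ψ‖ ^ 2 := by rw [tsum_mul_left, ← ψ.norm_sq]; ring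

theorem schur_memℓp {K : ℤ → ℤ → ℝ} (hK : HasSchurBound K) (ψ : EllTwo) :
    Memℓp (fun n => ∑' m, (K n m : ℂ) * ψ m) 2 := by
  obtain ⟨M, h1, h2⟩ := hK
  refine memℓp_gen' (C := M ^ 2 * ‖ψ‖ ^ 2) fun s => ?_
  simpa using schur_sum_le h1 h2 ψ s

/-- The bounded operator on `ℓ²(ℤ)` with matrix `K`: `(K ψ)_n = ∑_m K_{nm} ψ_m`. -/
noncomputable def matrixOp (K : ℤ → ℤ → ℝ) (hK : HasSchurBound K) : EllTwo →L[ℂ] EllTwo :=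
  LinearMap.mkContinuousOfExistsBound
    { toFun := fun ψ => ⟨fun n => ∑' m, (K n m : ℂ) * ψ m, schur_memℓp hK ψ⟩
      map_add' := fun ψ φ => by
        ext n
        have h := (schur_summable hK ψ n).tsum_add (schur_summable hK φ n)
        change ∑' m, (K n m : ℂ) * (ψ m + φ m)
          = ∑' m, (K n m : ℂ) * ψ m + ∑' m, (K n m : ℂ) * φ m
        simpa only [mul_add] using h
      map_smul' := fun c ψ => by
        ext n
        have h : ∑' m, c * ((K n m : ℂ) * ψ m) = c * ∑' m, (K n m : ℂ) * ψ m := tsum_mul_left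
        change ∑' m, (K n m : ℂ) * (c * ψ m) = c * ∑' m, (K n m : ℂ) * ψ m
        simpa only [mul_left_comm] using h }
    (by
      obtain ⟨M, h1, h2⟩ := hK
      have hM : 0 ≤ M := by simpa using h1 0 ∅
      refine ⟨M, fun ψ => ?_⟩
      refine lp.norm_le_of_forall_sum_le (by norm_num) (by positivity) fun s => ?_
      simpa [mul_pow] using schur_sum_le h1 h2 ψ s)

theorem matrixOp_apply {K : ℤ → ℤ → ℝ} (hK : HasSchurBound K) (ψ : EllTwo) (n : ℤ) :
    matrixOp K hK ψ n = ∑' m, (K n m : ℂ) * ψ m := rfl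

theorem matrixOp_adjoint {K : ℤ → ℤ → ℝ} (hK : HasSchurBound K) :
    (matrixOp K hK).adjoint = matrixOp (fun n m => K m n) hK.transpose := by
  ext φ m
  have h1 : (matrixOp K hK).adjoint φ m
      = inner ℂ (lp.single 2 m (1 : ℂ)) ((matrixOp K hK).adjoint φ) := by
    rw [lp.inner_single_left]; simp
  rw [h1, ContinuousLinearMap.adjoint_inner_right, lp.inner_eq_tsum, matrixOp_apply]
  refine tsum_congr fun n => ?_
  have h2 : matrixOp K hK (lp.single 2 m (1 : ℂ)) n = (K n m : ℂ) := by
    rw [matrixOp_apply, tsum_eq_single m]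
    · simp
    · intro k hk
      simp [hk]
  rw [h2]
  simp [mul_comm]

theorem shift_hasSchurBound (a : ℤ) :
    HasSchurBound fun n m => if m = n + a then (1 : ℝ) else 0 := by
  refine ⟨1, fun n s => ?_, fun m s => ?_⟩
  · have h : ∀ m, |if m = n + a then (1 : ℝ) else 0| = if m = n + a then 1 else 0 := by
      intro m; split_ifs <;> simp
    simp only [h, Finset.sum_ite_eq']
    split_ifs <;> norm_num
  · have h : ∀ n, |if m = n + a then (1 : ℝ) else 0| = if n = m - a then 1 else 0 := by
      intro n
      by_cases hn : m = n + a
      · simp [hn]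
      · have : n ≠ m - a := fun h => hn (by omega)
        simp [hn, this]
    simp only [h, Finset.sum_ite_eq']
    split_ifs <;> norm_num

/-- The translation `(ψ_n)_n ↦ (ψ_{n + a})_n` on `ℓ²(ℤ)`. -/
noncomputable def translation (a : ℤ) : EllTwo →L[ℂ] EllTwo :=
  matrixOp (fun n m => if m = n + a then (1 : ℝ) else 0) (shift_hasSchurBound a)

theorem translation_apply (a : ℤ) (ψ : EllTwo) (n : ℤ) : translation a ψ n = ψ (n + a) := by
  rw [translation, matrixOp_apply, tsum_eq_single (n + a)]
  · simp
  · intro m hm; simp [hm]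

/-- An interlayer hopping function: a real, even, smooth, exponentially decaying function. -/
structure HoppingFunction where
  /-- The underlying function. -/
  toFun : ℝ → ℝ
  even : ∀ η, toFun (-η) = toFun η
  smooth : ContDiff ℝ ∞ toFun
  decay : ∃ C c : ℝ, 0 < c ∧ ∀ η, |toFun η| ≤ C * Real.exp (-c * |η|)

instance : CoeFun HoppingFunction fun _ => ℝ → ℝ := ⟨HoppingFunction.toFun⟩

theorem exists_sum_exp_le {c : ℝ} (hc : 0 < c) :
    ∃ M : ℝ, ∀ (y : ℝ) (s : Finset ℤ), ∑ m ∈ s, Real.exp (-c * |(m : ℝ) - y|) ≤ M := by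
  have hsum : Summable fun m : ℤ => Real.exp (-c * |(m : ℝ)|) := by
    have hn : Summable fun n : ℕ => Real.exp (-c * (n : ℝ)) := by
      have := Real.summable_exp_nat_mul_iff.mpr (neg_lt_zero.mpr hc)
      refine this.congr fun n => ?_
      rw [mul_comm]
    refine Summable.of_nat_of_neg ?_ ?_ <;> simpa using hn
  refine ⟨Real.exp c * ∑' m : ℤ, Real.exp (-c * |(m : ℝ)|), fun y s => ?_⟩
  have hshift : Summable fun m : ℤ => Real.exp (-c * |((m - ⌊y⌋ : ℤ) : ℝ)|) :=
    (Equiv.subRight ⌊y⌋).summable_iff.mpr hsum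
  have hts : ∑' m : ℤ, Real.exp (-c * |((m - ⌊y⌋ : ℤ) : ℝ)|)
      = ∑' m : ℤ, Real.exp (-c * |(m : ℝ)|) :=
    (Equiv.subRight ⌊y⌋).tsum_eq fun m : ℤ => Real.exp (-c * |(m : ℝ)|)
  calc ∑ m ∈ s, Real.exp (-c * |(m : ℝ) - y|)
      ≤ ∑ m ∈ s, Real.exp c * Real.exp (-c * |((m - ⌊y⌋ : ℤ) : ℝ)|) := by
        refine Finset.sum_le_sum fun m _ => ?_
        rw [← Real.exp_add, Real.exp_le_exp]
        have h1 : |((m - ⌊y⌋ : ℤ) : ℝ)| ≤ |(m : ℝ) - y| + 1 := by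
          have : ((m - ⌊y⌋ : ℤ) : ℝ) = ((m : ℝ) - y) + Int.fract y := by
            push_cast; rw [Int.fract]; ring
          rw [this]
          refine (abs_add_le _ _).trans ?_
          rw [abs_of_nonneg (Int.fract_nonneg y)]
          linarith [Int.fract_lt_one y]
        nlinarith
    _ = Real.exp c * ∑ m ∈ s, Real.exp (-c * |((m - ⌊y⌋ : ℤ) : ℝ)|) := by rw [Finset.mul_sum]
    _ ≤ Real.exp c * ∑' m : ℤ, Real.exp (-c * |(m : ℝ)|) := by
        rw [← hts]
        exact mul_le_mul_of_nonneg_left (hshift.sum_le_tsum s fun _ _ => (Real.exp_pos _).le)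
          (Real.exp_pos _).le

theorem hopping_hasSchurBound (h : HoppingFunction) {θ : ℝ} (hθ : θ < 1) (b : ℝ) :
    HasSchurBound fun n n' => h ((n : ℝ) - (1 - θ) * (n' : ℝ) - b) := by
  obtain ⟨C, c, hc, hd⟩ := h.decay
  have hα : 0 < 1 - θ := by linarith
  have hC : 0 ≤ C := by
    have := (abs_nonneg _).trans (hd 0)
    simpa using this
  obtain ⟨M₁, hM₁⟩ := exists_sum_exp_le hc
  obtain ⟨M₂, hM₂⟩ := exists_sum_exp_le (mul_pos hc hα)
  refine ⟨C * max M₁ M₂, fun n s => ?_, fun n' s => ?_⟩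
  · calc ∑ n' ∈ s, |h ((n : ℝ) - (1 - θ) * (n' : ℝ) - b)|
        ≤ ∑ n' ∈ s, C * Real.exp (-(c * (1 - θ)) * |(n' : ℝ) - ((n : ℝ) - b) / (1 - θ)|) := by
          refine Finset.sum_le_sum fun n' _ => (hd _).trans_eq ?_
          have : (n : ℝ) - (1 - θ) * (n' : ℝ) - b
              = -((1 - θ) * ((n' : ℝ) - ((n : ℝ) - b) / (1 - θ))) := by
            field_simp; ring
          rw [this, abs_neg, abs_mul, abs_of_pos hα]
          congr 2; ring
      _ ≤ C * max M₁ M₂ := by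
          rw [← Finset.mul_sum]
          exact mul_le_mul_of_nonneg_left ((hM₂ _ s).trans (le_max_right _ _)) hC
  · calc ∑ n ∈ s, |h ((n : ℝ) - (1 - θ) * (n' : ℝ) - b)|
        ≤ ∑ n ∈ s, C * Real.exp (-c * |(n : ℝ) - ((1 - θ) * (n' : ℝ) + b)|) := by
          refine Finset.sum_le_sum fun n _ => (hd _).trans_eq ?_
          rw [sub_sub]
      _ ≤ C * max M₁ M₂ := by
          rw [← Finset.mul_sum]
          exact mul_le_mul_of_nonneg_left ((hM₁ _ s).trans (le_max_left _ _)) hC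

/-- Hopping from the chain to the fictitious second chain:
`ψ ↦ (∑_{n''} h(n'' - (1 - θ) n' - b) ψ_{n''})_{n'}`. -/
noncomputable def hopToSecond (h : HoppingFunction) (θ : ℝ) (hθ : θ < 1) (b : ℝ) :
    EllTwo →L[ℂ] EllTwo :=
  matrixOp (fun n' n'' => h ((n'' : ℝ) - (1 - θ) * (n' : ℝ) - b))
    (hopping_hasSchurBound h hθ b).transpose

/-- Hopping back from the fictitious second chain:
`φ ↦ (∑_{n'} h(n - (1 - θ) n' - b) φ_{n'})_n`. -/
noncomputable def hopFromSecond (h : HoppingFunction) (θ : ℝ) (hθ : θ < 1) (b : ℝ) :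
    EllTwo →L[ℂ] EllTwo :=
  matrixOp (fun n n' => h ((n : ℝ) - (1 - θ) * (n' : ℝ) - b)) (hopping_hasSchurBound h hθ b)

/-- The reduced incommensurate coupled chain Hamiltonian `H_r(b)` on `ℓ²(ℤ)`; the coordinate
formula is `reducedHamiltonian_apply`. -/
noncomputable def reducedHamiltonian (h : HoppingFunction) (θ : ℝ) (hθ : θ < 1) (b : ℝ) :
    EllTwo →L[ℂ] EllTwo :=
  translation 1 + translation (-1) + (hopFromSecond h θ hθ b) ∘L (hopToSecond h θ hθ b)

theorem reducedHamiltonian_apply (h : HoppingFunction) (θ : ℝ) (hθ : θ < 1) (b : ℝ)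
    (ψ : EllTwo) (n : ℤ) :
    reducedHamiltonian h θ hθ b ψ n = ψ (n + 1) + ψ (n - 1)
      + ∑' n' : ℤ, (h ((n : ℝ) - (1 - θ) * (n' : ℝ) - b) : ℂ)
          * ∑' n'' : ℤ, (h ((n'' : ℝ) - (1 - θ) * (n' : ℝ) - b) : ℂ) * ψ n'' := by
  have h1 : reducedHamiltonian h θ hθ b ψ n = translation 1 ψ n + translation (-1) ψ n
      + hopFromSecond h θ hθ b (hopToSecond h θ hθ b ψ) n := rfl
  rw [h1, translation_apply, translation_apply]
  rfl

theorem reducedHamiltonian_isSelfAdjoint (h : HoppingFunction) (θ : ℝ) (hθ : θ < 1) (b : ℝ) :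
    IsSelfAdjoint (reducedHamiltonian h θ hθ b) := by
  have ht : ∀ a : ℤ, star (translation a) = translation (-a) := by
    intro a
    rw [ContinuousLinearMap.star_eq_adjoint, translation, matrixOp_adjoint, translation]
    congr 1
    funext n m
    congr 1
    exact propext ⟨fun h => by omega, fun h => by omega⟩
  have h12 : star (hopToSecond h θ hθ b) = hopFromSecond h θ hθ b := by
    rw [ContinuousLinearMap.star_eq_adjoint, hopToSecond, matrixOp_adjoint]; rfl
  have h21 : star (hopFromSecond h θ hθ b) = hopToSecond h θ hθ b := by
    rw [← h12, star_star]
  have hH : reducedHamiltonian h θ hθ b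
      = translation 1 + translation (-1) + hopFromSecond h θ hθ b * hopToSecond h θ hθ b := rfl
  rw [IsSelfAdjoint, hH, star_add, star_add, star_mul, ht, ht, h12, h21, neg_neg,
    add_comm (translation (-1))]

theorem restrict_hasSchurBound (Λ : Finset ℤ) :
    HasSchurBound fun n m => if n = m ∧ n ∈ Λ then (1 : ℝ) else 0 := by
  have key : ∀ (k : ℤ) (s : Finset ℤ), ∑ m ∈ s, (if m = k then (1 : ℝ) else 0) ≤ 1 := by
    intro k s
    rw [Finset.sum_ite_eq']
    split_ifs <;> norm_num
  refine ⟨1, fun n s => (Finset.sum_le_sum fun m _ => ?_).trans (key n s),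
    fun m s => (Finset.sum_le_sum fun n _ => ?_).trans (key m s)⟩ <;>
  · by_cases hnm : n = m
    · subst hnm
      by_cases hn : n ∈ Λ <;> simp [hn]
    · simp [hnm, Ne.symm hnm]

/-- The operator `1_Λ` of multiplication by the characteristic function of `Λ`. -/
noncomputable def restrictTo (Λ : Finset ℤ) : EllTwo →L[ℂ] EllTwo :=
  matrixOp (fun n m => if n = m ∧ n ∈ Λ then (1 : ℝ) else 0) (restrict_hasSchurBound Λ)

theorem restrictTo_apply (Λ : Finset ℤ) (ψ : EllTwo) (n : ℤ) :
    restrictTo Λ ψ n = if n ∈ Λ then ψ n else 0 := by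
  rw [restrictTo, matrixOp_apply, tsum_eq_single n]
  · by_cases hn : n ∈ Λ <;> simp [hn]
  · intro m hm; simp [hm.symm]

/-- `Λ_L = [-L, L] ∩ ℤ`. -/
noncomputable def box (L : ℕ) : Finset ℤ := Finset.Icc (-(L : ℤ)) (L : ℤ)

/-- The truncated operator `H_{r,L}(b) = 1_{Λ_L} H_r(b) 1_{Λ_L}`. -/
noncomputable def truncatedHamiltonian (h : HoppingFunction) (θ : ℝ) (hθ : θ < 1) (L : ℕ)
    (b : ℝ) : EllTwo →L[ℂ] EllTwo :=
  restrictTo (box L) ∘L reducedHamiltonian h θ hθ b ∘L restrictTo (box L)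

theorem truncatedHamiltonian_isSelfAdjoint (h : HoppingFunction) (θ : ℝ) (hθ : θ < 1) (L : ℕ)
    (b : ℝ) : IsSelfAdjoint (truncatedHamiltonian h θ hθ L b) := by
  have hr : star (restrictTo (box L)) = restrictTo (box L) := by
    rw [ContinuousLinearMap.star_eq_adjoint, restrictTo, matrixOp_adjoint]
    congr 1
    funext n m
    congr 1
    exact propext ⟨fun h => ⟨h.1.symm, h.1 ▸ h.2⟩, fun h => ⟨h.1.symm, h.1 ▸ h.2⟩⟩
  have hc := (reducedHamiltonian_isSelfAdjoint h θ hθ b).conjugate (restrictTo (box L))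
  rw [hr, mul_assoc] at hc
  exact hc

/-- The operator `g(T)` for a self-adjoint bounded operator `T` and a continuous function
`g : ℝ → ℂ`, through the continuous functional calculus (the spectrum of `T` is real, so the
extension `z ↦ g (re z)` of `g` to `ℂ` plays no role off the real axis). -/
noncomputable def functionOf (g : ℝ → ℂ) (T : EllTwo →L[ℂ] EllTwo) : EllTwo →L[ℂ] EllTwo :=
  cfc (fun z : ℂ => g z.re) T

/-- The diagonal matrix element `⟨δ_x, g(T) δ_x⟩`. -/
noncomputable def diagElement (g : ℝ → ℂ) (T : EllTwo →L[ℂ] EllTwo) (x : ℤ) : ℂ :=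
  inner ℂ (deltaVec x) (functionOf g T (deltaVec x))

/-! Translating the chain by an integer `x` conjugates `H_r(b)` into `H_r(b - x)`, so `⟨δ_x,
g(H_r(b)) δ_x⟩ = F(b - x)` with `F(b) = ⟨δ_0, g(H_r(b)) δ_0⟩` (`diagElement_reducedHamiltonian`).
Shifting `b` by `1 - θ` only relabels the second chain, so `F` has period `1 - θ`; it is continuous
because `H_r(b)` is norm-continuous in `b`. As `1 - θ` is irrational, the points `b - x`
equidistribute modulo `1 - θ`, and the box averages of `F(b - x)` tend to the mean of `F` over a
period (`tendsto_boxAverage_of_periodic`).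

It remains to replace `H_r` by its truncation. At sites farther than a fixed `M` from the boundary
of the box the diagonal elements change little (`exists_norm_diagElement_truncated_sub_le`); the
other `2M` sites contribute boundedly and vanish in the average (`tendsto_boxAverage_zero`).

The interior estimate rests on compactness: by continuity and periodicity the vectors `H_r(b)^k
δ_0`, over all `b`, form a compact subset of `ℓ²(ℤ)`, hence have uniformly small tails, and
covariance carries this to every `δ_x`. Induction on `k` compares powers of the two operators,
linearity gives polynomials, and Weierstrass approximation on an interval containing all the spectra
gives continuous `g`. -/

/-! ### Equidistribution of the integers modulo an irrational period -/

theorem card_box (L : ℕ) : (box L).card = 2 * L + 1 := by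
  rw [box, Int.card_Icc]; omega

theorem box_succ (L : ℕ) :
    box (L + 1) = insert (-((L : ℤ) + 1)) (insert ((L : ℤ) + 1) (box L)) := by
  ext x
  simp only [box, Finset.mem_insert, Finset.mem_Icc]
  push_cast
  omega

theorem sum_box_succ (f : ℤ → ℂ) (L : ℕ) :
    ∑ x ∈ box (L + 1), f x = f (-((L : ℤ) + 1)) + (f ((L : ℤ) + 1) + ∑ x ∈ box L, f x) := by
  rw [box_succ, Finset.sum_insert, Finset.sum_insert]
  · simp [box]
  · simp only [box, Finset.mem_insert, Finset.mem_Icc]; omega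

/-- The symmetric geometric sum. -/
theorem sub_one_mul_sum_box_zpow {z : ℂ} (hz : z ≠ 0) (L : ℕ) :
    (z - 1) * ∑ x ∈ box L, z ^ x = z ^ ((L : ℤ) + 1) - z ^ (-(L : ℤ)) := by
  induction L with
  | zero => simp [box]
  | succ L ih =>
    rw [sum_box_succ, mul_add, mul_add, ih]
    have h1 : z ^ (((L + 1 : ℕ) : ℤ) + 1) = z * z ^ ((L : ℤ) + 1) := by
      push_cast; rw [zpow_add_one₀ hz ((L : ℤ) + 1), mul_comm]
    have h2 : z ^ (-(L : ℤ)) = z * z ^ (-((L : ℤ) + 1)) := by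
      rw [mul_comm, ← zpow_add_one₀ hz]; congr 1; ring
    rw [h1, h2]
    push_cast
    ring

theorem norm_sum_box_zpow_le {z : ℂ} (hz : ‖z‖ = 1) (L : ℕ) :
    ‖z - 1‖ * ‖∑ x ∈ box L, z ^ x‖ ≤ 2 := by
  have h0 : z ≠ 0 := by rintro rfl; simp at hz
  rw [← norm_mul, sub_one_mul_sum_box_zpow h0]
  refine (norm_sub_le _ _).trans ?_
  rw [norm_zpow, norm_zpow, hz, one_zpow, one_zpow]
  norm_num

theorem tendsto_one_div_card_box :
    Tendsto (fun L : ℕ => (1 : ℝ) / ((box L).card : ℝ)) atTop (𝓝 0) := by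
  refine squeeze_zero (fun L => by positivity) (fun L => ?_) tendsto_one_div_add_atTop_nhds_zero_nat
  rw [card_box]
  push_cast
  gcongr
  have : (0 : ℝ) ≤ L := by positivity
  linarith

theorem tendsto_boxAverage_zpow {z : ℂ} (hz : ‖z‖ = 1) (hz1 : z ≠ 1) :
    Tendsto (fun L : ℕ => (1 / ((box L).card : ℂ)) * ∑ x ∈ box L, z ^ x) atTop (𝓝 0) := by
  have hpos : 0 < ‖z - 1‖ := norm_pos_iff.mpr (sub_ne_zero.mpr hz1)
  rw [tendsto_zero_iff_norm_tendsto_zero]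
  have h := tendsto_one_div_card_box.mul_const (2 / ‖z - 1‖)
  rw [zero_mul] at h
  refine squeeze_zero (fun L => norm_nonneg _) (fun L => ?_) h
  rw [norm_mul, norm_div, norm_one, Complex.norm_natCast]
  refine mul_le_mul_of_nonneg_left ?_ (by positivity)
  rw [le_div_iff₀ hpos, mul_comm]
  exact norm_sum_box_zpow_le hz L

/-- Irrationality excludes resonance: `exp(-2πin/T) = 1` would give `-n = mT` with `m ≠ 0`, making
`T` rational. -/
theorem fourier_neg_one_ne_one {T : ℝ} [hT : Fact (0 < T)] (hirr : Irrational T) {n : ℤ}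
    (hn : n ≠ 0) : fourier n ((-1 : ℝ) : AddCircle T) ≠ 1 := by
  have hT0 : T ≠ 0 := hT.out.ne'
  rw [fourier_coe_apply, Ne, Complex.exp_eq_one_iff]
  rintro ⟨m, hm⟩
  have hpi : (2 * (Real.pi : ℂ) * Complex.I) ≠ 0 := Complex.two_pi_I_ne_zero
  have hTc : (T : ℂ) ≠ 0 := by exact_mod_cast hT0
  have h1 : (-(n : ℂ)) = m * T := by
    push_cast at hm
    field_simp at hm
    linear_combination hm
  have h2 : (-(n : ℝ)) = m * T := by exact_mod_cast h1
  have hm0 : m ≠ 0 := by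
    rintro rfl
    apply hn
    have : (n : ℝ) = 0 := by simpa using h2
    exact_mod_cast this
  have hmR : (m : ℝ) ≠ 0 := by exact_mod_cast hm0
  refine hirr ⟨(-n : ℚ) / m, ?_⟩
  push_cast
  rw [h2]
  field_simp

theorem intervalIntegral_fourier {T : ℝ} [hT : Fact (0 < T)] {n : ℤ} (hn : n ≠ 0) :
    ∫ t in (0 : ℝ)..T, fourier n (t : AddCircle T) = 0 := by
  have hTc : (T : ℂ) ≠ 0 := by exact_mod_cast hT.out.ne'
  have hnc : (n : ℂ) ≠ 0 := by exact_mod_cast hn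
  have hc : 2 * (Real.pi : ℂ) * Complex.I * n / T ≠ 0 :=
    div_ne_zero (mul_ne_zero Complex.two_pi_I_ne_zero hnc) hTc
  have h1 : ∀ t : ℝ, fourier n (t : AddCircle T)
      = Complex.exp (2 * (Real.pi : ℂ) * Complex.I * n / T * t) := by
    intro t
    rw [fourier_coe_apply]
    congr 1
    ring
  simp only [h1]
  rw [integral_exp_mul_complex hc]
  have h2 : 2 * (Real.pi : ℂ) * Complex.I * n / T * T = n * (2 * Real.pi * Complex.I) := by
    field_simp
  rw [h2, Complex.exp_int_mul_two_pi_mul_I]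
  simp

/-- A character turns the orbit `b - x` into a constant times `z ^ x` with `|z| = 1`. For `n ≠ 0`
one has `z ≠ 1`, so the geometric sums stay bounded while the box grows; for `n = 0` both sides are
`1`. -/
theorem tendsto_boxAverage_fourier {T : ℝ} [hT : Fact (0 < T)] (hirr : Irrational T) (n : ℤ)
    (b : ℝ) :
    Tendsto (fun L : ℕ => (1 / ((box L).card : ℂ))
        * ∑ x ∈ box L, fourier n ((b - x : ℝ) : AddCircle T)) atTop
      (𝓝 ((1 / (T : ℂ)) * ∫ t in (0 : ℝ)..T, fourier n (t : AddCircle T))) := by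
  have hTc : (T : ℂ) ≠ 0 := by exact_mod_cast hT.out.ne'
  rcases eq_or_ne n 0 with rfl | hn
  · have h : ∀ L : ℕ, (1 / ((box L).card : ℂ))
        * ∑ x ∈ box L, fourier 0 ((b - x : ℝ) : AddCircle T) = 1 := by
      intro L
      have hL : ((box L).card : ℂ) ≠ 0 := by
        rw [card_box]; exact_mod_cast (2 * L).succ_ne_zero
      simp only [fourier_zero, Finset.sum_const, nsmul_eq_mul, mul_one]
      field_simp
    rw [funext h]
    simp [hTc]
  · rw [intervalIntegral_fourier hn, mul_zero]
    set z : ℂ := fourier n ((-1 : ℝ) : AddCircle T) with hz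
    have hzn : ‖z‖ = 1 := by rw [hz, fourier_apply]; exact Circle.norm_coe _
    have h1 : ∀ x : ℤ, fourier n ((b - x : ℝ) : AddCircle T)
        = fourier n (b : AddCircle T) * z ^ x := by
      intro x
      rw [hz, fourier_coe_apply, fourier_coe_apply, fourier_coe_apply, ← Complex.exp_int_mul,
        ← Complex.exp_add]
      congr 1
      push_cast
      ring
    simp only [h1, ← Finset.mul_sum]
    have h2 := (tendsto_boxAverage_zpow hzn (fourier_neg_one_ne_one hirr hn)).const_mul
      (fourier n (b : AddCircle T))
    rw [mul_zero] at h2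
    refine h2.congr fun L => ?_
    ring

theorem norm_boxAverage_le {f : ℤ → ℂ} {ε : ℝ} (hf : ∀ x, ‖f x‖ ≤ ε) (L : ℕ) :
    ‖(1 / ((box L).card : ℂ)) * ∑ x ∈ box L, f x‖ ≤ ε := by
  have hL : (0 : ℝ) < (box L).card := by rw [card_box]; positivity
  rw [norm_mul, norm_div, norm_one, Complex.norm_natCast, one_div, inv_mul_le_iff₀ hL]
  refine (norm_sum_le _ _).trans ?_
  rw [← nsmul_eq_mul]
  exact Finset.sum_le_card_nsmul _ _ _ fun x _ => hf x

theorem norm_intervalAverage_le {T : ℝ} (hT : 0 < T) {f : ℝ → ℂ} {ε : ℝ} (hf : ∀ x, ‖f x‖ ≤ ε) :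
    ‖(1 / (T : ℂ)) * ∫ t in (0 : ℝ)..T, f t‖ ≤ ε := by
  rw [norm_mul, norm_div, norm_one, Complex.norm_real, Real.norm_of_nonneg hT.le, one_div,
    inv_mul_le_iff₀ hT]
  refine (intervalIntegral.norm_integral_le_of_norm_le_const fun x _ => hf x).trans ?_
  rw [sub_zero, abs_of_pos hT, mul_comm]

theorem continuous_comp_coe_addCircle {T : ℝ} (F : C(AddCircle T, ℂ)) :
    Continuous fun t : ℝ => F (t : AddCircle T) :=
  F.continuous.comp (AddCircle.continuous_mk' T)

/-- Weyl equidistribution of the integers modulo an irrational period. -/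
theorem tendsto_boxAverage_addCircle {T : ℝ} [hT : Fact (0 < T)] (hirr : Irrational T)
    (F : C(AddCircle T, ℂ)) (b : ℝ) :
    Tendsto (fun L : ℕ => (1 / ((box L).card : ℂ))
        * ∑ x ∈ box L, F ((b - x : ℝ) : AddCircle T)) atTop
      (𝓝 ((1 / (T : ℂ)) * ∫ t in (0 : ℝ)..T, F (t : AddCircle T))) := by
  -- Both sides are linear in the function and bounded by its sup norm, so it suffices to treat
  -- trigonometric polynomials, which are uniformly dense.
  have hspan : ∀ P ∈ Submodule.span ℂ (Set.range (@fourier T)),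
      Tendsto (fun L : ℕ => (1 / ((box L).card : ℂ))
        * ∑ x ∈ box L, P ((b - x : ℝ) : AddCircle T)) atTop
      (𝓝 ((1 / (T : ℂ)) * ∫ t in (0 : ℝ)..T, P (t : AddCircle T))) := by
    intro P hP
    induction hP using Submodule.span_induction with
    | mem P hP =>
      obtain ⟨n, rfl⟩ := hP
      exact tendsto_boxAverage_fourier hirr n b
    | zero => simp
    | add P Q _ _ ihP ihQ =>
      have h := ihP.add ihQ
      rw [← mul_add, ← intervalIntegral.integral_add
        ((continuous_comp_coe_addCircle P).intervalIntegrable _ _)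
        ((continuous_comp_coe_addCircle Q).intervalIntegrable _ _)] at h
      refine h.congr fun L => ?_
      rw [← mul_add, ← Finset.sum_add_distrib]
      rfl
    | smul c P _ ih =>
      have h := ih.const_mul c
      rw [mul_left_comm, ← intervalIntegral.integral_const_mul] at h
      refine h.congr fun L => ?_
      rw [mul_left_comm, Finset.mul_sum]
      rfl
  rw [Metric.tendsto_atTop]
  intro ε hε
  have hF : F ∈ closure ((Submodule.span ℂ (Set.range (@fourier T)) : Submodule ℂ _) : Set _) := by
    rw [← Submodule.topologicalClosure_coe, span_fourier_closure_eq_top]; trivial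
  obtain ⟨P, hP, hFP⟩ := Metric.mem_closure_iff.mp hF (ε / 3) (by positivity)
  obtain ⟨N, hN⟩ := Metric.tendsto_atTop.mp (hspan P hP) (ε / 3) (by positivity)
  have hpt : ∀ y, ‖F y - P y‖ ≤ ε / 3 := fun y => by
    rw [← dist_eq_norm]; exact (ContinuousMap.dist_apply_le_dist y).trans hFP.le
  refine ⟨N, fun L hL => ?_⟩
  have h1 := norm_boxAverage_le (fun x : ℤ => hpt ((b - x : ℝ) : AddCircle T)) L
  have h2 := norm_intervalAverage_le hT.out (fun t : ℝ => hpt (t : AddCircle T))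
  rw [Finset.sum_sub_distrib, mul_sub] at h1
  rw [intervalIntegral.integral_sub ((continuous_comp_coe_addCircle F).intervalIntegrable _ _)
    ((continuous_comp_coe_addCircle P).intervalIntegrable _ _), mul_sub] at h2
  have h3 := hN L hL
  rw [← dist_eq_norm] at h1 h2
  rw [dist_comm] at h2
  refine (dist_triangle4 _ _ _ _).trans_lt
    (add_lt_add_of_lt_of_le (add_lt_add_of_le_of_lt h1 h3) h2 |>.trans_eq (by ring))

theorem tendsto_boxAverage_of_periodic {T : ℝ} (hT : 0 < T) (hirr : Irrational T) {F : ℝ → ℂ}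
    (hF : Continuous F) (hper : Function.Periodic F T) (b : ℝ) :
    Tendsto (fun L : ℕ => (1 / ((box L).card : ℂ)) * ∑ x ∈ box L, F (b - x)) atTop
      (𝓝 ((1 / (T : ℂ)) * ∫ t in (0 : ℝ)..T, F t)) := by
  have : Fact (0 < T) := ⟨hT⟩
  let F' : C(AddCircle T, ℂ) :=
    ⟨hper.lift, continuous_coinduced_dom.mpr hF⟩
  exact tendsto_boxAverage_addCircle hirr F' b

/-! ### Norm continuity and periodicity in the interlayer shift -/

/-- Schur's test applied to the kernel `K - K'`. The constant is kept explicit here, since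
`HasSchurBound` only asserts that one exists. -/
theorem norm_matrixOp_sub_le {K K' : ℤ → ℤ → ℝ} (hK : HasSchurBound K) (hK' : HasSchurBound K')
    {M : ℝ} (h1 : ∀ n (s : Finset ℤ), ∑ m ∈ s, |K n m - K' n m| ≤ M)
    (h2 : ∀ m (s : Finset ℤ), ∑ n ∈ s, |K n m - K' n m| ≤ M) :
    ‖matrixOp K hK - matrixOp K' hK'‖ ≤ M := by
  have hM : 0 ≤ M := by simpa using h1 0 ∅
  refine ContinuousLinearMap.opNorm_le_bound _ hM fun ψ => ?_
  refine lp.norm_le_of_forall_sum_le (by norm_num) (by positivity) fun s => ?_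
  have hcoe : ∀ n, (matrixOp K hK - matrixOp K' hK') ψ n
      = ∑' m, ((K n m - K' n m : ℝ) : ℂ) * ψ m := by
    intro n
    have h3 : (matrixOp K hK - matrixOp K' hK') ψ n = matrixOp K hK ψ n - matrixOp K' hK' ψ n := rfl
    rw [h3, matrixOp_apply, matrixOp_apply,
      ← (schur_summable hK ψ n).tsum_sub (schur_summable hK' ψ n)]
    refine tsum_congr fun m => ?_
    push_cast
    ring
  simp only [hcoe]
  simpa [mul_pow] using schur_sum_le (K := fun n m => K n m - K' n m) h1 h2 ψ s

/-- Uniform Schur bounds for kernels decaying exponentially off the line `n = α n' + b`. -/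
theorem exists_schur_bound_of_exp_decay {c α : ℝ} (hc : 0 < c) (hα : 0 < α) :
    ∃ M : ℝ, 0 < M ∧ ∀ (C b : ℝ) (f : ℤ → ℤ → ℝ), 0 ≤ C →
      (∀ n n', |f n n'| ≤ C * Real.exp (-c * |(n : ℝ) - α * (n' : ℝ) - b|)) →
      (∀ n (s : Finset ℤ), ∑ n' ∈ s, |f n n'| ≤ C * M) ∧
        ∀ n' (s : Finset ℤ), ∑ n ∈ s, |f n n'| ≤ C * M := by
  obtain ⟨M₁, hM₁⟩ := exists_sum_exp_le hc
  obtain ⟨M₂, hM₂⟩ := exists_sum_exp_le (mul_pos hc hα)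
  -- The `1` makes the constant positive, so that a prescribed error can later be divided by it.
  refine ⟨max 1 (max M₁ M₂), by positivity, fun C b f hC hf => ⟨fun n s => ?_, fun n' s => ?_⟩⟩
  · calc ∑ n' ∈ s, |f n n'|
        ≤ ∑ n' ∈ s, C * Real.exp (-(c * α) * |(n' : ℝ) - ((n : ℝ) - b) / α|) := by
          refine Finset.sum_le_sum fun n' _ => (hf _ _).trans_eq ?_
          have : (n : ℝ) - α * (n' : ℝ) - b = -(α * ((n' : ℝ) - ((n : ℝ) - b) / α)) := by
            field_simp; ring
          rw [this, abs_neg, abs_mul, abs_of_pos hα]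
          congr 2; ring
      _ ≤ C * max 1 (max M₁ M₂) := by
          rw [← Finset.mul_sum]
          exact mul_le_mul_of_nonneg_left
            ((hM₂ _ s).trans ((le_max_right _ _).trans (le_max_right _ _))) hC
  · calc ∑ n ∈ s, |f n n'|
        ≤ ∑ n ∈ s, C * Real.exp (-c * |(n : ℝ) - (α * (n' : ℝ) + b)|) := by
          refine Finset.sum_le_sum fun n _ => (hf _ _).trans_eq ?_
          rw [sub_sub]
      _ ≤ C * max 1 (max M₁ M₂) := by
          rw [← Finset.mul_sum]
          exact mul_le_mul_of_nonneg_left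
            ((hM₁ _ s).trans ((le_max_left _ _).trans (le_max_right _ _))) hC

namespace HoppingFunction

theorem uniformContinuous (h : HoppingFunction) : UniformContinuous h.toFun := by
  obtain ⟨C, c, hc, hd⟩ := h.decay
  refine h.smooth.continuous.uniformContinuous_of_tendsto_cocompact (x := 0) ?_
  have h1 : Tendsto (fun η : ℝ => C * Real.exp (-c * |η|)) (cocompact ℝ) (𝓝 0) := by
    have h2 : Tendsto (fun η : ℝ => -c * |η|) (cocompact ℝ) atBot :=
      (tendsto_norm_cocompact_atTop (E := ℝ)).const_mul_atTop_of_neg (neg_lt_zero.mpr hc)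
    simpa using (Real.tendsto_exp_atBot.comp h2).const_mul C
  exact squeeze_zero_norm hd h1

/-- Small increments of a hopping function are small with exponential weight. -/
theorem exists_abs_sub_le (h : HoppingFunction) :
    ∃ c : ℝ, 0 < c ∧ ∀ η > 0, ∃ δ > 0, ∀ u v : ℝ, |u - v| < δ →
      |h u - h v| ≤ η * Real.exp (-c * |u|) := by
  obtain ⟨C, c, hc, hd⟩ := h.decay
  have hC : 0 ≤ C := by
    have := (abs_nonneg _).trans (hd 0)
    simpa using this
  set D : ℝ := C * (1 + Real.exp c) with hD
  have hD0 : 0 ≤ D := by positivity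
  -- The increment is bounded both by a small constant, from uniform continuity, and by `D *
  -- exp(-c|u|)`, from decay. The geometric mean of the two bounds is small and still decays, at
  -- half the rate.
  refine ⟨c / 2, by positivity, fun η hη => ?_⟩
  obtain ⟨δ, hδ, huc⟩ := Metric.uniformContinuous_iff.mp h.uniformContinuous
    (η ^ 2 / (D + 1)) (by positivity)
  -- The cutoff at `1` gives `|u| ≤ |v| + 1`, the source of the factor `exp c` in `D`.
  refine ⟨min δ 1, by positivity, fun u v huv => ?_⟩
  have h1 : |h u - h v| ≤ η ^ 2 / (D + 1) := by
    have := huc (a := u) (b := v) (by rw [Real.dist_eq]; exact huv.trans_le (min_le_left _ _))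
    rw [Real.dist_eq] at this
    exact this.le
  have h2 : |h u - h v| ≤ D * Real.exp (-c * |u|) := by
    have h3 : Real.exp (-c * |v|) ≤ Real.exp c * Real.exp (-c * |u|) := by
      rw [← Real.exp_add, Real.exp_le_exp]
      have : |u| ≤ |v| + 1 := by
        have h4 := abs_sub_abs_le_abs_sub u v
        have h5 := huv.trans_le (min_le_right _ _)
        linarith
      nlinarith
    calc |h u - h v| ≤ |h u| + |h v| := abs_sub _ _
      _ ≤ C * Real.exp (-c * |u|) + C * (Real.exp c * Real.exp (-c * |u|)) :=
          add_le_add (hd u) ((hd v).trans (mul_le_mul_of_nonneg_left h3 hC))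
      _ = D * Real.exp (-c * |u|) := by rw [hD]; ring
  refine (pow_le_pow_iff_left₀ (abs_nonneg _) (by positivity) two_ne_zero).mp ?_
  have h7 : Real.exp (-(c / 2) * |u|) ^ 2 = Real.exp (-c * |u|) := by
    rw [← Real.exp_nat_mul]; congr 1; push_cast; ring
  rw [mul_pow, h7]
  calc |h u - h v| ^ 2 = |h u - h v| * |h u - h v| := sq _
    _ ≤ η ^ 2 / (D + 1) * (D * Real.exp (-c * |u|)) :=
        mul_le_mul h1 h2 (abs_nonneg _) (by positivity)
    _ = η ^ 2 * Real.exp (-c * |u|) * (D / (D + 1)) := by ring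
    _ ≤ η ^ 2 * Real.exp (-c * |u|) * 1 := by
        refine mul_le_mul_of_nonneg_left ?_ (by positivity)
        rw [div_le_one (by positivity)]
        linarith
    _ = η ^ 2 * Real.exp (-c * |u|) := mul_one _

end HoppingFunction

/-- Changing `b` moves every argument of `h` by the same amount, so the weighted increment bound can
be summed along rows and columns. The resulting `δ` does not depend on the base point. -/
theorem exists_schur_bound_hopping_sub (h : HoppingFunction) {θ : ℝ} (hθ : θ < 1) :
    ∀ ε > 0, ∃ δ > 0, ∀ b b' : ℝ, |b - b'| < δ →
      (∀ (n : ℤ) (s : Finset ℤ), ∑ n' ∈ s,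
        |h ((n : ℝ) - (1 - θ) * (n' : ℝ) - b) - h ((n : ℝ) - (1 - θ) * (n' : ℝ) - b')| ≤ ε) ∧
      ∀ (n' : ℤ) (s : Finset ℤ), ∑ n ∈ s,
        |h ((n : ℝ) - (1 - θ) * (n' : ℝ) - b) - h ((n : ℝ) - (1 - θ) * (n' : ℝ) - b')| ≤ ε := by
  obtain ⟨c, hc, hsub⟩ := h.exists_abs_sub_le
  obtain ⟨M, hM, hbound⟩ := exists_schur_bound_of_exp_decay hc (sub_pos.mpr hθ)
  intro ε hε
  obtain ⟨δ, hδ, hd⟩ := hsub (ε / M) (by positivity)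
  refine ⟨δ, hδ, fun b b' hbb => ?_⟩
  have h1 := hbound (ε / M) b (fun n n' => h ((n : ℝ) - (1 - θ) * (n' : ℝ) - b)
    - h ((n : ℝ) - (1 - θ) * (n' : ℝ) - b')) (by positivity) fun n n' => hd _ _ (by
      rw [sub_sub_sub_cancel_left, abs_sub_comm]; exact hbb)
  rw [div_mul_cancel₀ _ hM.ne'] at h1
  exact h1

theorem continuous_hopFromSecond (h : HoppingFunction) (θ : ℝ) (hθ : θ < 1) :
    Continuous (hopFromSecond h θ hθ) := by
  rw [Metric.continuous_iff]
  intro b ε hε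
  obtain ⟨δ, hδ, hd⟩ := exists_schur_bound_hopping_sub h hθ (ε / 2) (by positivity)
  refine ⟨δ, hδ, fun b' hb' => ?_⟩
  obtain ⟨h1, h2⟩ := hd b' b hb'
  rw [dist_eq_norm]
  exact (norm_matrixOp_sub_le _ _ h1 h2).trans_lt (half_lt_self hε)

theorem continuous_hopToSecond (h : HoppingFunction) (θ : ℝ) (hθ : θ < 1) :
    Continuous (hopToSecond h θ hθ) := by
  rw [Metric.continuous_iff]
  intro b ε hε
  obtain ⟨δ, hδ, hd⟩ := exists_schur_bound_hopping_sub h hθ (ε / 2) (by positivity)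
  refine ⟨δ, hδ, fun b' hb' => ?_⟩
  obtain ⟨h1, h2⟩ := hd b' b hb'
  rw [dist_eq_norm]
  exact (norm_matrixOp_sub_le _ _ h2 h1).trans_lt (half_lt_self hε)

/-- The Hamiltonian depends norm-continuously on the interlayer shift. -/
theorem continuous_reducedHamiltonian (h : HoppingFunction) (θ : ℝ) (hθ : θ < 1) :
    Continuous (reducedHamiltonian h θ hθ) :=
  continuous_const.add ((continuous_hopFromSecond h θ hθ).clm_comp (continuous_hopToSecond h θ hθ))

/-- Moving the second chain by its own lattice constant is the relabelling `n' ↦ n' + 1` of the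
inner sum. -/
theorem reducedHamiltonian_periodic (h : HoppingFunction) (θ : ℝ) (hθ : θ < 1) :
    Function.Periodic (reducedHamiltonian h θ hθ) (1 - θ) := by
  intro b
  ext ψ n
  rw [reducedHamiltonian_apply, reducedHamiltonian_apply]
  congr 1
  rw [← (Equiv.addRight (1 : ℤ)).tsum_eq fun n' : ℤ =>
    (h ((n : ℝ) - (1 - θ) * (n' : ℝ) - b) : ℂ)
      * ∑' n'' : ℤ, (h ((n'' : ℝ) - (1 - θ) * (n' : ℝ) - b) : ℂ) * ψ n'']
  have harg : ∀ m n' : ℤ, (m : ℝ) - (1 - θ) * (n' : ℝ) - (b + (1 - θ))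
      = (m : ℝ) - (1 - θ) * ((n' + 1 : ℤ) : ℝ) - b := by
    intro m n'; push_cast; ring
  simp only [harg, Equiv.coe_addRight]

theorem exists_norm_reducedHamiltonian_le (h : HoppingFunction) (θ : ℝ) (hθ : θ < 1) :
    ∃ R : ℝ, 0 ≤ R ∧ ∀ b, ‖reducedHamiltonian h θ hθ b‖ ≤ R := by
  obtain ⟨R, hR⟩ := ((reducedHamiltonian_periodic h θ hθ).isBounded_of_continuous
    (sub_pos.mpr hθ).ne' (continuous_reducedHamiltonian h θ hθ)).exists_norm_le
  exact ⟨R, (norm_nonneg _).trans (hR _ ⟨0, rfl⟩), fun b => hR _ ⟨b, rfl⟩⟩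

/-! ### Covariance under integer translations -/

theorem star_translation (a : ℤ) : star (translation a) = translation (-a) := by
  rw [ContinuousLinearMap.star_eq_adjoint, translation, matrixOp_adjoint, translation]
  congr 1
  funext n m
  congr 1
  exact propext ⟨fun h => by omega, fun h => by omega⟩

theorem translation_mul_neg (a : ℤ) : translation a * translation (-a) = 1 := by
  ext ψ n
  rw [mul_apply_eq_comp, translation_apply, translation_apply, add_neg_cancel_right]
  rfl

theorem translation_neg_mul (a : ℤ) : translation (-a) * translation a = 1 := by
  simpa using translation_mul_neg (-a)

theorem translation_mem_unitary (a : ℤ) : translation a ∈ unitary (EllTwo →L[ℂ] EllTwo) := by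
  rw [Unitary.mem_iff, star_translation]
  exact ⟨translation_neg_mul a, translation_mul_neg a⟩

theorem deltaVec_apply (x n : ℤ) : deltaVec x n = if n = x then 1 else 0 := by
  by_cases hn : n = x
  · subst hn; simp [deltaVec]
  · simp [deltaVec, hn]

theorem translation_deltaVec (a x : ℤ) : translation a (deltaVec x) = deltaVec (x - a) := by
  ext n
  rw [translation_apply, deltaVec_apply, deltaVec_apply]
  simp only [eq_sub_iff_add_eq]

theorem norm_deltaVec (x : ℤ) : ‖deltaVec x‖ = 1 := by
  rw [deltaVec, lp.norm_single (by norm_num), norm_one]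

theorem translation_mul_reducedHamiltonian (h : HoppingFunction) (θ : ℝ) (hθ : θ < 1) (b : ℝ)
    (a : ℤ) : translation a * reducedHamiltonian h θ hθ b
      = reducedHamiltonian h θ hθ (b - a) * translation a := by
  ext ψ n
  rw [mul_apply_eq_comp, mul_apply_eq_comp, translation_apply,
    reducedHamiltonian_apply, reducedHamiltonian_apply, translation_apply, translation_apply,
    add_right_comm n 1 a, sub_add_eq_add_sub n 1 a]
  congr 1
  refine tsum_congr fun n' => ?_
  rw [← (Equiv.addRight a).tsum_eq fun n'' : ℤ =>
    (h ((n'' : ℝ) - (1 - θ) * (n' : ℝ) - b) : ℂ) * ψ n'']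
  have harg : ∀ m : ℤ, ((m + a : ℤ) : ℝ) - (1 - θ) * (n' : ℝ) - b
      = (m : ℝ) - (1 - θ) * (n' : ℝ) - (b - a) := by
    intro m; push_cast; ring
  simp only [harg, Equiv.coe_addRight, translation_apply]

/-- Covariance is phrased through a star-algebra automorphism because continuous star homomorphisms
commute with the functional calculus. -/
theorem reducedHamiltonian_sub_int (h : HoppingFunction) (θ : ℝ) (hθ : θ < 1) (b : ℝ) (a : ℤ) :
    reducedHamiltonian h θ hθ (b - a) = Unitary.conjStarAlgAut ℂ _
      ⟨translation a, translation_mem_unitary a⟩ (reducedHamiltonian h θ hθ b) := by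
  rw [Unitary.conjStarAlgAut_apply]
  change _ = translation a * reducedHamiltonian h θ hθ b * star (translation a)
  rw [translation_mul_reducedHamiltonian, star_translation, mul_assoc, translation_mul_neg, mul_one]

theorem reducedHamiltonian_isStarNormal (h : HoppingFunction) (θ : ℝ) (hθ : θ < 1) (b : ℝ) :
    IsStarNormal (reducedHamiltonian h θ hθ b) :=
  (reducedHamiltonian_isSelfAdjoint h θ hθ b).isStarNormal

theorem continuous_conjStarAlgAut (U : unitary (EllTwo →L[ℂ] EllTwo)) :
    Continuous (Unitary.conjStarAlgAut ℂ (EllTwo →L[ℂ] EllTwo) U) := by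
  have h : (Unitary.conjStarAlgAut ℂ (EllTwo →L[ℂ] EllTwo) U : _ → _)
      = fun x => (U : EllTwo →L[ℂ] EllTwo) * x * star (U : EllTwo →L[ℂ] EllTwo) := by
    funext x; exact Unitary.conjStarAlgAut_apply _ _
  rw [h]
  fun_prop

/-- Covariance of the diagonal elements under translations. -/
theorem diagElement_reducedHamiltonian (h : HoppingFunction) (θ : ℝ) (hθ : θ < 1) {g : ℝ → ℂ}
    (hg : Continuous g) (b : ℝ) (x : ℤ) :
    diagElement g (reducedHamiltonian h θ hθ b) x
      = diagElement g (reducedHamiltonian h θ hθ (b - x)) 0 := by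
  have hn := reducedHamiltonian_isStarNormal h θ hθ b
  have hn' := reducedHamiltonian_isStarNormal h θ hθ (b - x)
  have hcfc : functionOf g (reducedHamiltonian h θ hθ (b - x)) = translation x
      * functionOf g (reducedHamiltonian h θ hθ b) * translation (-x) := by
    -- The normality witness must also be put in conjugated form, as `StarAlgHomClass.map_cfc` asks
    -- for normality of the image.
    rw [reducedHamiltonian_sub_int] at hn' ⊢
    have hc : Continuous fun z : ℂ => g z.re := hg.comp Complex.continuous_re
    have h1 := StarAlgHomClass.map_cfc (Unitary.conjStarAlgAut ℂ (EllTwo →L[ℂ] EllTwo)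
      ⟨translation x, translation_mem_unitary x⟩) (fun z : ℂ => g z.re)
      (reducedHamiltonian h θ hθ b) hc.continuousOn (continuous_conjStarAlgAut _) hn hn'
    rw [functionOf, functionOf, ← h1, Unitary.conjStarAlgAut_apply, ← star_translation]
  rw [diagElement, diagElement, hcfc, mul_apply_eq_comp, mul_apply_eq_comp, translation_deltaVec,
    ← ContinuousLinearMap.adjoint_inner_left (translation x), ← ContinuousLinearMap.star_eq_adjoint,
    star_translation, translation_deltaVec]
  simp

/-! ### Continuity of the diagonal elements in the shift -/

theorem spectrum_subset_closedBall {T : EllTwo →L[ℂ] EllTwo} {R : ℝ} (hT : ‖T‖ ≤ R) :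
    spectrum ℂ T ⊆ Metric.closedBall 0 R :=
  (spectrum.subset_closedBall_norm_mul T).trans <| Metric.closedBall_subset_closedBall <|
    (mul_le_of_le_one_right (norm_nonneg _) ContinuousLinearMap.norm_id_le).trans hT

/-- The norms of `H_r(b)` are bounded uniformly in `b`, so one compact ball contains all the
spectra; on such a family the functional calculus is norm-continuous. -/
theorem continuous_diagElement_reducedHamiltonian (h : HoppingFunction) (θ : ℝ) (hθ : θ < 1)
    {g : ℝ → ℂ} (hg : Continuous g) (x : ℤ) :
    Continuous fun b => diagElement g (reducedHamiltonian h θ hθ b) x := by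
  obtain ⟨R, -, hR⟩ := exists_norm_reducedHamiltonian_le h θ hθ
  have hc : Continuous fun z : ℂ => g z.re := hg.comp Complex.continuous_re
  have h1 : Continuous fun b => functionOf g (reducedHamiltonian h θ hθ b) :=
    Continuous.cfc' (isCompact_closedBall (0 : ℂ) R) _ (continuous_reducedHamiltonian h θ hθ)
      (fun b => spectrum_subset_closedBall (hR b)) hc.continuousOn
      (fun b => reducedHamiltonian_isStarNormal h θ hθ b)
  exact continuous_const.inner (h1.clm_apply continuous_const)

theorem norm_diagElement_le (g : ℝ → ℂ) (T : EllTwo →L[ℂ] EllTwo) (x : ℤ) :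
    ‖diagElement g T x‖ ≤ ‖functionOf g T‖ := by
  refine (norm_inner_le_norm _ _).trans ?_
  refine (mul_le_mul_of_nonneg_left (ContinuousLinearMap.le_opNorm _ _) (norm_nonneg _)).trans ?_
  simp [norm_deltaVec]

/-! ### Uniform tails and the truncation of powers -/

theorem EllTwo.norm_le_of_forall_apply_le {φ ψ : EllTwo} (h : ∀ n, ‖φ n‖ ≤ ‖ψ n‖) :
    ‖φ‖ ≤ ‖ψ‖ := by
  refine (pow_le_pow_iff_left₀ (norm_nonneg _) (norm_nonneg _) two_ne_zero).mp ?_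
  rw [φ.norm_sq, ψ.norm_sq]
  exact φ.summable_sq.tsum_le_tsum (fun n => pow_le_pow_left₀ (norm_nonneg _) (h n) 2) ψ.summable_sq

theorem norm_restrictTo_apply_le (Λ : Finset ℤ) (ψ : EllTwo) : ‖restrictTo Λ ψ‖ ≤ ‖ψ‖ := by
  refine EllTwo.norm_le_of_forall_apply_le fun n => ?_
  rw [restrictTo_apply]
  split_ifs <;> simp

theorem sub_restrictTo_apply (Λ : Finset ℤ) (ψ : EllTwo) (n : ℤ) :
    (ψ - restrictTo Λ ψ) n = if n ∈ Λ then 0 else ψ n := by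
  have h : (ψ - restrictTo Λ ψ) n = ψ n - restrictTo Λ ψ n := rfl
  rw [h, restrictTo_apply]
  split_ifs <;> simp

theorem norm_sub_restrictTo_le (Λ : Finset ℤ) (ψ : EllTwo) : ‖ψ - restrictTo Λ ψ‖ ≤ ‖ψ‖ := by
  refine EllTwo.norm_le_of_forall_apply_le fun n => ?_
  rw [sub_restrictTo_apply]
  split_ifs <;> simp

theorem restrictTo_eq_sum_single (Λ : Finset ℤ) (ψ : EllTwo) :
    restrictTo Λ ψ = ∑ i ∈ Λ, lp.single 2 i (ψ i) := by
  ext n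
  rw [restrictTo_apply, lp.coeFn_sum, Finset.sum_apply]
  simp only [lp.coeFn_single, Pi.single_apply]
  rw [Finset.sum_ite_eq]

theorem tendsto_box : Tendsto box atTop atTop := by
  refine tendsto_atTop_finset_of_monotone (fun L L' h x hx => ?_) fun x => ⟨x.natAbs, ?_⟩
  · simp only [box, Finset.mem_Icc] at hx ⊢
    omega
  · simp only [box, Finset.mem_Icc]
    omega

theorem tendsto_norm_sub_restrictTo_box (ψ : EllTwo) :
    Tendsto (fun L => ‖ψ - restrictTo (box L) ψ‖) atTop (𝓝 0) := by
  have h0 : Tendsto (fun s : Finset ℤ => ∑ i ∈ s, lp.single 2 i (ψ i)) atTop (𝓝 ψ) := by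
    simpa [HasSum] using lp.hasSum_single (p := 2) (by norm_num) ψ
  have h1 : Tendsto (fun L => ∑ i ∈ box L, lp.single 2 i (ψ i)) atTop (𝓝 ψ) :=
    h0.comp tendsto_box
  simp only [← restrictTo_eq_sum_single] at h1
  simpa using (h1.const_sub ψ).norm

/-- The tails of the elements of a compact subset of `ℓ²(ℤ)` are uniformly small. -/
theorem IsCompact.exists_norm_sub_restrictTo_box_le {K : Set EllTwo} (hK : IsCompact K) {ε : ℝ}
    (hε : 0 < ε) : ∃ M : ℕ, ∀ ψ ∈ K, ‖ψ - restrictTo (box M) ψ‖ ≤ ε := by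
  -- One box serves a finite `ε / 2`-net, and cutting off the box does not increase the distance to
  -- the net.
  obtain ⟨t, ht, hcov⟩ := Metric.totallyBounded_iff.mp hK.totallyBounded (ε / 2) (by positivity)
  have hev : ∀ᶠ L in atTop, ∀ φ ∈ t, ‖φ - restrictTo (box L) φ‖ < ε / 2 :=
    (eventually_all_finite ht).mpr fun φ _ =>
      (tendsto_norm_sub_restrictTo_box φ).eventually_lt_const (by positivity)
  obtain ⟨M, hM⟩ := hev.exists
  refine ⟨M, fun ψ hψ => ?_⟩
  obtain ⟨φ, hφ, hd⟩ := Set.mem_iUnion₂.mp (hcov hψ)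
  rw [Metric.mem_ball, dist_eq_norm] at hd
  have h1 : ψ - restrictTo (box M) ψ
      = (ψ - φ - restrictTo (box M) (ψ - φ)) + (φ - restrictTo (box M) φ) := by
    rw [map_sub]; abel
  rw [h1]
  refine (norm_add_le _ _).trans ?_
  have h2 := norm_sub_restrictTo_le (box M) (ψ - φ)
  have h3 := hM φ hφ
  linarith

theorem norm_translation_apply (a : ℤ) (ψ : EllTwo) : ‖translation a ψ‖ = ‖ψ‖ := by
  refine (pow_left_inj₀ (norm_nonneg _) (norm_nonneg _) two_ne_zero).mp ?_
  rw [EllTwo.norm_sq, EllTwo.norm_sq]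
  simp only [translation_apply]
  exact (Equiv.addRight a).tsum_eq fun n => ‖ψ n‖ ^ 2

theorem translation_reducedHamiltonian_pow_deltaVec (h : HoppingFunction) (θ : ℝ) (hθ : θ < 1)
    (b : ℝ) (k : ℕ) (x : ℤ) :
    translation x ((reducedHamiltonian h θ hθ b ^ k) (deltaVec x))
      = (reducedHamiltonian h θ hθ (b - x) ^ k) (deltaVec 0) := by
  have h1 : SemiconjBy (translation x) (reducedHamiltonian h θ hθ b)
      (reducedHamiltonian h θ hθ (b - x)) := translation_mul_reducedHamiltonian h θ hθ b x
  have h2 := congrArg (fun T : EllTwo →L[ℂ] EllTwo => T (deltaVec x)) (h1.pow_right k).eq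
  simp only [mul_apply_eq_comp, translation_deltaVec, sub_self] at h2
  exact h2

/-- A continuous periodic function has compact range. This takes the place of quantitative
off-diagonal decay of the powers. -/
theorem isCompact_range_reducedHamiltonian_pow_deltaVec (h : HoppingFunction) (θ : ℝ) (hθ : θ < 1)
    (k : ℕ) :
    IsCompact (Set.range fun b => (reducedHamiltonian h θ hθ b ^ k) (deltaVec 0)) :=
  Function.Periodic.compact_of_continuous (c := 1 - θ)
    (fun b => by simp only [reducedHamiltonian_periodic h θ hθ b]) (sub_pos.mpr hθ).ne'
    (((continuous_reducedHamiltonian h θ hθ).pow k).clm_apply continuous_const)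

theorem exists_norm_sub_restrictTo_pow_deltaVec_le (h : HoppingFunction) (θ : ℝ) (hθ : θ < 1)
    (k : ℕ) {ε : ℝ} (hε : 0 < ε) :
    ∃ M : ℕ, ∀ (b : ℝ) (L : ℕ) (x : ℤ), |x| + M ≤ L →
      ‖(reducedHamiltonian h θ hθ b ^ k) (deltaVec x)
        - restrictTo (box L) ((reducedHamiltonian h θ hθ b ^ k) (deltaVec x))‖ ≤ ε := by
  obtain ⟨M, hM⟩ := (isCompact_range_reducedHamiltonian_pow_deltaVec h θ hθ
    k).exists_norm_sub_restrictTo_box_le hε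
  refine ⟨M, fun b L x hx => ?_⟩
  refine le_trans ?_ (hM _ ⟨b - x, rfl⟩)
  simp only [← translation_reducedHamiltonian_pow_deltaVec h θ hθ b k x]
  set w := (reducedHamiltonian h θ hθ b ^ k) (deltaVec x)
  rw [← norm_translation_apply x (w - restrictTo (box L) w)]
  refine EllTwo.norm_le_of_forall_apply_le fun n => ?_
  rw [translation_apply, sub_restrictTo_apply, sub_restrictTo_apply, translation_apply]
  have hx' := neg_abs_le x
  have hx'' := le_abs_self x
  simp only [box, Finset.mem_Icc]
  split_ifs with h1 h2 h2
  · rfl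
  · simp
  -- Since `|x| + M ≤ L`, the box of radius `M` centred at `x` lies inside `box L`, so this case is
  -- empty.
  · exfalso; omega
  · rfl

theorem norm_truncatedHamiltonian_le {h : HoppingFunction} {θ : ℝ} {hθ : θ < 1} {b R : ℝ}
    (hR : ‖reducedHamiltonian h θ hθ b‖ ≤ R) (L : ℕ) : ‖truncatedHamiltonian h θ hθ L b‖ ≤ R := by
  refine ContinuousLinearMap.opNorm_le_bound _ ((norm_nonneg _).trans hR) fun ψ => ?_
  refine (norm_restrictTo_apply_le _ _).trans ?_
  refine (ContinuousLinearMap.le_of_opNorm_le _ hR _).trans ?_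
  exact mul_le_mul_of_nonneg_left (norm_restrictTo_apply_le _ _) ((norm_nonneg _).trans hR)

/-- With `P` the restriction to the box, `PAPv - Av = -PA(v - Pv) - (Av - PAv)`: truncation errs
only through the tails of `v` and `Av`. -/
theorem norm_truncatedHamiltonian_sub_apply_le {h : HoppingFunction} {θ : ℝ} {hθ : θ < 1}
    {b R : ℝ} (hR : ‖reducedHamiltonian h θ hθ b‖ ≤ R) (L : ℕ) (v : EllTwo) :
    ‖truncatedHamiltonian h θ hθ L b v - reducedHamiltonian h θ hθ b v‖
      ≤ R * ‖v - restrictTo (box L) v‖ + ‖reducedHamiltonian h θ hθ b v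
        - restrictTo (box L) (reducedHamiltonian h θ hθ b v)‖ := by
  set A := reducedHamiltonian h θ hθ b
  set P := restrictTo (box L) with hP
  have h1 : truncatedHamiltonian h θ hθ L b v - A v = -(P (A (v - P v))) - (A v - P (A v)) := by
    change P (A (P v)) - A v = _
    rw [map_sub, map_sub]; abel
  rw [h1]
  refine (norm_sub_le _ _).trans ?_
  rw [norm_neg]
  gcongr
  exact (norm_restrictTo_apply_le _ _).trans (ContinuousLinearMap.le_of_opNorm_le _ hR _)

theorem exists_norm_truncatedHamiltonian_pow_sub_le (h : HoppingFunction) (θ : ℝ) (hθ : θ < 1)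
    (k : ℕ) : ∀ ε > 0, ∃ M : ℕ, ∀ (b : ℝ) (L : ℕ) (x : ℤ), |x| + M ≤ L →
      ‖(truncatedHamiltonian h θ hθ L b ^ k) (deltaVec x)
        - (reducedHamiltonian h θ hθ b ^ k) (deltaVec x)‖ ≤ ε := by
  obtain ⟨R, hR0, hR⟩ := exists_norm_reducedHamiltonian_le h θ hθ
  induction k with
  | zero => exact fun ε hε => ⟨0, fun b L x _ => by simpa using hε.le⟩
  | succ k ih =>
    intro ε hε
    -- With `T` the truncation of `A`, write `T^(k+1) - A^(k+1) = T(T^k - A^k) + (T - A)A^k` on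
    -- `δ_x`. The first term is controlled by induction, the second by the tails of `A^k δ_x` and
    -- `A^(k+1) δ_x`. Dividing by `R + 1` rather than `R` allows `R = 0`.
    obtain ⟨M₁, hM₁⟩ := ih (ε / (3 * (R + 1))) (by positivity)
    obtain ⟨M₂, hM₂⟩ := exists_norm_sub_restrictTo_pow_deltaVec_le h θ hθ k
      (ε := ε / (3 * (R + 1))) (by positivity)
    obtain ⟨M₃, hM₃⟩ := exists_norm_sub_restrictTo_pow_deltaVec_le h θ hθ (k + 1)
      (ε := ε / 3) (by positivity)
    refine ⟨M₁ + M₂ + M₃, fun b L x hx => ?_⟩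
    have h1 := hM₁ b L x (by omega)
    have h2 := hM₂ b L x (by omega)
    have h3 := hM₃ b L x (by omega)
    rw [pow_succ', mul_apply_eq_comp] at h3
    rw [pow_succ', pow_succ', mul_apply_eq_comp, mul_apply_eq_comp]
    have h4 := norm_truncatedHamiltonian_sub_apply_le (hR b) L
      ((reducedHamiltonian h θ hθ b ^ k) (deltaVec x))
    have h5 := ContinuousLinearMap.le_of_opNorm_le _ (norm_truncatedHamiltonian_le (hR b) L)
      ((truncatedHamiltonian h θ hθ L b ^ k) (deltaVec x)
        - (reducedHamiltonian h θ hθ b ^ k) (deltaVec x))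
    rw [map_sub] at h5
    have h6 : R * (ε / (3 * (R + 1))) ≤ ε / 3 := by
      rw [show R * (ε / (3 * (R + 1))) = ε / 3 * (R / (R + 1)) by field_simp]
      exact mul_le_of_le_one_right (by positivity) ((div_le_one (by positivity)).mpr (by linarith))
    have h7 := mul_le_mul_of_nonneg_left h1 hR0
    have h8 := mul_le_mul_of_nonneg_left h2 hR0
    refine (norm_sub_le_norm_sub_add_norm_sub _ _ _).trans
      ((add_le_add h5 h4).trans ?_)
    linarith

/-! ### From powers to continuous functions -/

theorem exists_norm_truncatedHamiltonian_aeval_sub_le (h : HoppingFunction) (θ : ℝ) (hθ : θ < 1)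
    (p : Polynomial ℂ) : ∀ ε > 0, ∃ M : ℕ, ∀ (b : ℝ) (L : ℕ) (x : ℤ), |x| + M ≤ L →
      ‖(Polynomial.aeval (truncatedHamiltonian h θ hθ L b) p) (deltaVec x)
        - (Polynomial.aeval (reducedHamiltonian h θ hθ b) p) (deltaVec x)‖ ≤ ε := by
  induction p using Polynomial.induction_on' with
  | add p q ihp ihq =>
    intro ε hε
    obtain ⟨M₁, hM₁⟩ := ihp (ε / 2) (by positivity)
    obtain ⟨M₂, hM₂⟩ := ihq (ε / 2) (by positivity)
    refine ⟨M₁ + M₂, fun b L x hx => ?_⟩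
    rw [map_add, map_add, add_apply, add_apply,
      add_sub_add_comm]
    refine (norm_add_le _ _).trans ?_
    have h1 := hM₁ b L x (by omega)
    have h2 := hM₂ b L x (by omega)
    linarith
  | monomial k c =>
    intro ε hε
    obtain ⟨M, hM⟩ := exists_norm_truncatedHamiltonian_pow_sub_le h θ hθ k (ε / (‖c‖ + 1))
      (by positivity)
    refine ⟨M, fun b L x hx => ?_⟩
    have h1 := hM b L x hx
    rw [Polynomial.aeval_monomial, Polynomial.aeval_monomial, ← Algebra.smul_def,
      ← Algebra.smul_def, smul_apply, smul_apply,
      ← smul_sub, norm_smul]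
    rw [le_div_iff₀ (by positivity)] at h1
    nlinarith [norm_nonneg c, norm_nonneg ((truncatedHamiltonian h θ hθ L b ^ k) (deltaVec x)
        - (reducedHamiltonian h θ hθ b ^ k) (deltaVec x))]

/-- Weierstrass approximation of a complex-valued function on a symmetric real interval. -/
theorem exists_complex_polynomial_near {g : ℝ → ℂ} (hg : Continuous g) (R : ℝ) {ε : ℝ}
    (hε : 0 < ε) : ∃ p : Polynomial ℂ, ∀ t : ℝ, |t| ≤ R → ‖g t - p.eval (t : ℂ)‖ ≤ ε := by
  obtain ⟨p, hp⟩ := exists_polynomial_near_of_continuousOn (-R) R (fun t => (g t).re)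
    (Complex.continuous_re.comp hg).continuousOn (ε / 2) (by positivity)
  obtain ⟨q, hq⟩ := exists_polynomial_near_of_continuousOn (-R) R (fun t => (g t).im)
    (Complex.continuous_im.comp hg).continuousOn (ε / 2) (by positivity)
  refine ⟨p.map Complex.ofRealHom + Polynomial.C Complex.I * q.map Complex.ofRealHom,
    fun t ht => ?_⟩
  have h1 := hp t (abs_le.mp ht)
  have h2 := hq t (abs_le.mp ht)
  have hev : ∀ r : Polynomial ℝ, (r.map Complex.ofRealHom).eval (t : ℂ) = ((r.eval t : ℝ) : ℂ) :=
    fun r => Polynomial.eval_map_apply Complex.ofRealHom t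
  rw [Polynomial.eval_add, Polynomial.eval_mul, Polynomial.eval_C, hev, hev]
  have hre := abs_sub_comm (p.eval t) (g t).re
  have him := abs_sub_comm (q.eval t) (g t).im
  refine (Complex.norm_le_abs_re_add_abs_im _).trans ?_
  simp only [Complex.sub_re, Complex.add_re, Complex.mul_re, Complex.sub_im, Complex.add_im,
    Complex.mul_im, Complex.ofReal_re, Complex.ofReal_im, Complex.I_re, Complex.I_im, zero_mul,
    one_mul, mul_zero, add_zero, zero_add, sub_self]
  linarith

theorem abs_re_le_of_mem_spectrum {T : EllTwo →L[ℂ] EllTwo} {R : ℝ} (hTR : ‖T‖ ≤ R)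
    {z : ℂ} (hz : z ∈ spectrum ℂ T) : |z.re| ≤ R :=
  (Complex.abs_re_le_norm z).trans (by simpa using spectrum_subset_closedBall hTR hz)

theorem exists_norm_functionOf_le {g : ℝ → ℂ} (hg : Continuous g) (R : ℝ) :
    ∃ B : ℝ, ∀ T : EllTwo →L[ℂ] EllTwo, ‖T‖ ≤ R → ‖functionOf g T‖ ≤ B := by
  obtain ⟨B, hB⟩ := (isCompact_Icc (a := -R) (b := R)).exists_bound_of_continuousOn hg.continuousOn
  -- `norm_cfc_le` needs a nonnegative bound; this also covers non-normal `T`, for which `cfc` takes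
  -- the default value `0`.
  refine ⟨max B 0, fun T hT => ?_⟩
  exact norm_cfc_le (le_max_right _ _) fun z hz =>
    (hB _ (abs_le.mp (abs_re_le_of_mem_spectrum hT hz))).trans (le_max_left _ _)

/-- The spectrum of a self-adjoint `T` is real, so there `p` at `z` equals `p` at `z.re`, and the
functional calculus is bounded by the supremum over the spectrum. -/
theorem norm_functionOf_sub_aeval_le {g : ℝ → ℂ} (hg : Continuous g) {R ε : ℝ} (hε : 0 ≤ ε)
    {p : Polynomial ℂ} (hp : ∀ t : ℝ, |t| ≤ R → ‖g t - p.eval (t : ℂ)‖ ≤ ε)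
    {T : EllTwo →L[ℂ] EllTwo} (hT : IsSelfAdjoint T) (hTR : ‖T‖ ≤ R) :
    ‖functionOf g T - Polynomial.aeval T p‖ ≤ ε := by
  have hn : IsStarNormal T := hT.isStarNormal
  have hc : Continuous fun z : ℂ => g z.re := hg.comp Complex.continuous_re
  rw [functionOf, ← cfc_polynomial p T hn,
    ← cfc_sub (fun z : ℂ => g z.re) p.eval T hc.continuousOn p.continuous.continuousOn]
  refine norm_cfc_le hε fun z hz => ?_
  have h1 := hp z.re (abs_re_le_of_mem_spectrum hTR hz)
  rwa [← hT.mem_spectrum_eq_re hz] at h1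

theorem norm_diagElement_sub_inner_le {g : ℝ → ℂ} {T S : EllTwo →L[ℂ] EllTwo} {ε : ℝ}
    (h : ‖functionOf g T - S‖ ≤ ε) (x : ℤ) :
    ‖diagElement g T x - inner ℂ (deltaVec x) (S (deltaVec x))‖ ≤ ε := by
  rw [diagElement, ← inner_sub_right, ← sub_apply]
  refine (norm_inner_le_norm _ _).trans ?_
  refine (mul_le_mul_of_nonneg_left (ContinuousLinearMap.le_of_opNorm_le _ h _)
    (norm_nonneg _)).trans ?_
  simp [norm_deltaVec]

/-- Away from the boundary of the box, the truncation barely changes the diagonal elements. -/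
theorem exists_norm_diagElement_truncated_sub_le (h : HoppingFunction) (θ : ℝ) (hθ : θ < 1)
    {g : ℝ → ℂ} (hg : Continuous g) {ε : ℝ} (hε : 0 < ε) :
    ∃ M : ℕ, ∀ (b : ℝ) (L : ℕ) (x : ℤ), |x| + M ≤ L →
      ‖diagElement g (truncatedHamiltonian h θ hθ L b) x
        - diagElement g (reducedHamiltonian h θ hθ b) x‖ ≤ ε := by
  obtain ⟨R, -, hR⟩ := exists_norm_reducedHamiltonian_le h θ hθ
  -- Truncation does not exceed the bound `R`, so one polynomial serves `H_r(b)` and all its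
  -- truncations, for every `b` and `L`.
  obtain ⟨p, hp⟩ := exists_complex_polynomial_near hg R (ε := ε / 3) (by positivity)
  obtain ⟨M, hM⟩ := exists_norm_truncatedHamiltonian_aeval_sub_le h θ hθ p (ε / 3) (by positivity)
  refine ⟨M, fun b L x hx => ?_⟩
  have h1 := norm_diagElement_sub_inner_le (norm_functionOf_sub_aeval_le hg (by positivity) hp
    (truncatedHamiltonian_isSelfAdjoint h θ hθ L b) (norm_truncatedHamiltonian_le (hR b) L)) x
  have h2 := norm_diagElement_sub_inner_le (norm_functionOf_sub_aeval_le hg (by positivity) hp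
    (reducedHamiltonian_isSelfAdjoint h θ hθ b) (hR b)) x
  have h3 := (norm_inner_le_norm (𝕜 := ℂ) (deltaVec x)
    ((Polynomial.aeval (truncatedHamiltonian h θ hθ L b) p) (deltaVec x)
        - (Polynomial.aeval (reducedHamiltonian h θ hθ b) p) (deltaVec x)))
  rw [norm_deltaVec, one_mul, inner_sub_right] at h3
  replace h3 := h3.trans (hM b L x hx)
  rw [← dist_eq_norm] at h1 h2 h3 ⊢
  rw [dist_comm] at h2
  exact (dist_triangle4 _ _ _ _).trans ((add_le_add (add_le_add h1 h3) h2).trans_eq (by ring))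

/-! ### Negligibility of the boundary and conclusion -/

theorem box_mono {L L' : ℕ} (h : L ≤ L') : box L ⊆ box L' := by
  intro x hx
  simp only [box, Finset.mem_Icc] at hx ⊢
  omega

/-- Bounded functions that are uniformly small away from the boundary have small box averages. -/
theorem tendsto_boxAverage_zero {d : ℕ → ℤ → ℂ} {B : ℝ} (hB : ∀ L x, ‖d L x‖ ≤ B)
    (hd : ∀ ε > 0, ∃ M : ℕ, ∀ (L : ℕ) (x : ℤ), |x| + M ≤ L → ‖d L x‖ ≤ ε) :
    Tendsto (fun L : ℕ => (1 / ((box L).card : ℂ)) * ∑ x ∈ box L, d L x) atTop (𝓝 0) := by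
  rw [Metric.tendsto_atTop]
  intro ε hε
  obtain ⟨M, hM⟩ := hd (ε / 2) (by positivity)
  have h1 : Tendsto (fun L : ℕ => 1 / ((box L).card : ℝ) * (2 * M * B)) atTop (𝓝 0) := by
    simpa using tendsto_one_div_card_box.mul_const (2 * M * B)
  obtain ⟨N, hN⟩ := eventually_atTop.mp
    (h1.eventually_lt_const (show (0 : ℝ) < ε / 2 by positivity))
  -- `L ≥ M` makes `L - M` a true difference; the sites outside `box (L - M)` then number exactly `2
  -- * M`.
  refine ⟨max N M, fun L hL => ?_⟩
  have hML : M ≤ L := (le_max_right _ _).trans hL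
  have hsub : box (L - M) ⊆ box L := box_mono (Nat.sub_le _ _)
  have hcard : (0 : ℝ) < (box L).card := by rw [card_box]; positivity
  have hin : ∑ x ∈ box (L - M), ‖d L x‖ ≤ (box L).card * (ε / 2) := by
    refine (Finset.sum_le_card_nsmul _ _ (ε / 2) fun x hx => hM L x ?_).trans ?_
    · simp only [box, Finset.mem_Icc] at hx
      have := abs_le.mpr hx
      omega
    · rw [nsmul_eq_mul]
      gcongr
  have hout : ∑ x ∈ box L \ box (L - M), ‖d L x‖ ≤ 2 * M * B := by
    refine (Finset.sum_le_card_nsmul _ _ B fun x _ => hB L x).trans_eq ?_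
    rw [Finset.card_sdiff_of_subset hsub, card_box, card_box, nsmul_eq_mul,
      show 2 * L + 1 - (2 * (L - M) + 1) = 2 * M by omega]
    push_cast
    ring
  rw [dist_zero_right, norm_mul, norm_div, norm_one, Complex.norm_natCast]
  calc 1 / ((box L).card : ℝ) * ‖∑ x ∈ box L, d L x‖
      ≤ 1 / ((box L).card : ℝ) * ((box L).card * (ε / 2) + 2 * M * B) := by
        refine mul_le_mul_of_nonneg_left ((norm_sum_le _ _).trans ?_) (by positivity)
        rw [← Finset.sum_sdiff hsub, add_comm]
        exact add_le_add hin hout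
    _ = ε / 2 + 1 / ((box L).card : ℝ) * (2 * M * B) := by field_simp
    _ < ε / 2 + ε / 2 := by
        gcongr
        exact hN L ((le_max_left _ _).trans hL)
    _ = ε := add_halves ε

theorem mainTheorem4 (θ : ℝ) (hθ₀ : 0 < θ) (hθ₁ : θ < 1) (hθ : Irrational θ)
    (h : HoppingFunction) (g : ℝ → ℂ) (hg : Continuous g) :
    IntervalIntegrable (fun b : ℝ => diagElement g (reducedHamiltonian h θ hθ₁ b) 0)
      volume 0 (1 - θ) ∧
    ∀ b ∈ Set.Ico (0 : ℝ) (1 - θ),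
      Tendsto
        (fun L : ℕ => (1 / ((box L).card : ℂ))
          * ∑ x ∈ box L, diagElement g (truncatedHamiltonian h θ hθ₁ L b) x)
        atTop
        (𝓝 ((1 / ((1 - θ : ℝ) : ℂ))
          * ∫ b' in (0 : ℝ)..(1 - θ), diagElement g (reducedHamiltonian h θ hθ₁ b') 0)) := by
  have hcont := continuous_diagElement_reducedHamiltonian h θ hθ₁ hg 0
  refine ⟨hcont.intervalIntegrable _ _, fun b _ => ?_⟩
  have hirr : Irrational (1 - θ) := by simpa using hθ.ratCast_sub 1
  have h1 := tendsto_boxAverage_of_periodic (sub_pos.mpr hθ₁) hirr hcont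
    (fun b' => by simp only [reducedHamiltonian_periodic h θ hθ₁ b']) b
  -- Covariance read backwards turns `F(b - x)` into the diagonal element of `H_r(b)` at `x`.
  simp only [← diagElement_reducedHamiltonian h θ hθ₁ hg] at h1
  obtain ⟨R, -, hR⟩ := exists_norm_reducedHamiltonian_le h θ hθ₁
  obtain ⟨B, hB⟩ := exists_norm_functionOf_le hg R
  have h2 := tendsto_boxAverage_zero
    (d := fun L x => diagElement g (truncatedHamiltonian h θ hθ₁ L b) x
      - diagElement g (reducedHamiltonian h θ hθ₁ b) x) (B := B + B)
    (fun L x => (norm_sub_le _ _).trans (add_le_add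
      ((norm_diagElement_le _ _ _).trans (hB _ (norm_truncatedHamiltonian_le (hR b) L)))
      ((norm_diagElement_le _ _ _).trans (hB _ (hR b)))))
    (fun ε hε => by
      obtain ⟨M, hM⟩ := exists_norm_diagElement_truncated_sub_le h θ hθ₁ hg hε
      exact ⟨M, fun L x hx => hM b L x hx⟩)
  have h3 := h2.add h1
  rw [zero_add] at h3
  refine h3.congr fun L => ?_
  rw [← mul_add, ← Finset.sum_add_distrib]
  simp only [sub_add_cancel]
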